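/- Let a qubit $S$ with Pauli matrices $X, Z$ be coupled to a bath with complex Hilbert space $\mathcal{H}_B$ through the dephasing Hamiltonian $H = I\otimes B_I + Z\otimes B_Z$, where $B_I, B_Z$ are bounded self-adjoint operators on $\mathcal{H}_B$. For $K\in\mathbb{N}$ and $T>0$ let $t_j = T\sin^2\!\big(\tfrac{j\pi}{2K+2}\big)$, $j=0,\dots,K+1$, and let the $K$-pulse Uhrig dynamical decoupling (UDD) protocol be $$D = D_K(T) = \prod_{j=0}^{K} X^{j}\, e^{-iH(t_{j+1}-t_j)}\, X^{j},$$ with later times on the left and $X$ acting as $X\otimes I$ (an $X$ pulse at each of $t_1,\dots,t_K$, and a closing $X$ pulse at time $T$ if $K$ is odd). Its randomization over the decoupling group $G=\{I,X\}$ is $$\mathcal{R}(\rho) = \frac{1}{|G|}\sum_{g\in G} (gDg^\dagger)\,\rho\,(gD^\dagger g^\dagger) = \tfrac12 D\rho D^\dagger + \tfrac12 XDX\,\rho\, XD^\dagger X .$$ For an initial state $\rho=\rho_S(0)\otimes\rho_B$ put $\rho_S(T)=\mathrm{tr}_B(D\rho D^\dagger)$ and $\rho_S^{\mathrm{ran}}(T)=\mathrm{tr}_B(\mathcal{R}(\rho))$.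 Then, as $T\to 0^+$, uniformly over all density operators $\rho_S(0)$ of the qubit and $\rho_B$ of the bath, $$\tfrac12\|\rho_S^{\mathrm{ran}}(T)-\rho_S(0)\|_1 = O(T^{2K+2}), \qquad \tfrac12\|\rho_S(T)-\rho_S(0)\|_1 = O(T^{K+1}),$$ where the implied constants and the range of $T$ depend only on $K$ and on the bath operators $B_I$ and $B_Z$. Moreover, for each $g\in G$, $gDg^\dagger$ is the evolution of total time $T$ generated by free evolution under $H$ and at most $K+2$ instantaneous pulses on the system, namely by the UDD sequence with $g^\dagger$ applied before its first step and its last pulse $X^K$ replaced by $gX^K$. -/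

import Mathlib

open Filter Topology

noncomputable section

namespace UDD

/-- Operators on the system qubit `ℂ²`. -/
abbrev SysOp : Type := Matrix (Fin 2) (Fin 2) ℂ

/-- Bounded operators on `ℂ² ⊗ B`, for a bath Hilbert space `B`, as `2 × 2` block matrices of
bounded operators on `B`. Product, adjoint (`ᴴ`) and topology are those of the bounded operators
on the Hilbert space tensor product. -/
abbrev JointOp (B : Type*) [NormedAddCommGroup B] [InnerProductSpace ℂ B] : Type _ :=
  Matrix (Fin 2) (Fin 2) (B →L[ℂ] B)

/-- The Pauli matrix `X`. -/
def pauliX : SysOp := !![0, 1; 1, 0]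

/-- The Pauli matrix `Z`. -/
def pauliZ : SysOp := !![1, 0; 0, -1]

open Classical in
/-- The decoupling group `G = {I, X}`. -/
def decouplingGroup : Finset SysOp := {1, pauliX}

/-- The trace norm of a square matrix: the sum of its singular values. -/
def traceNorm {n : Type*} [Fintype n] [DecidableEq n] (M : Matrix n n ℂ) : ℝ :=
  ∑ i, Real.sqrt ((Matrix.isHermitian_conjTranspose_mul_self M).eigenvalues i)

open scoped ComplexOrder in
/-- Density matrices of the system qubit. -/
def IsSystemState (ρ : SysOp) : Prop := ρ.PosSemidef ∧ ρ.trace = 1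

/-- The Uhrig switching times `t_j = T sin²(jπ / (2K + 2))`. They satisfy `t_0 = 0` and
`t_{K+1} = T`; the pulses are applied at `t_1, …, t_K`. -/
def uhrigTime (K : ℕ) (T : ℝ) (j : ℕ) : ℝ :=
  T * Real.sin (j * Real.pi / (2 * K + 2)) ^ 2

/-- The length of the free evolution interval `[t_j, t_{j+1}]`, for `j = 0, …, K`. -/
def uhrigInterval (K : ℕ) (T : ℝ) (j : ℕ) : ℝ :=
  uhrigTime K T (j + 1) - uhrigTime K T j

/-- The group element `g_j ∈ {I, X}` of the `j`-th interval: `I, X, I, X, …`. -/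
def toggle (j : ℕ) : SysOp := pauliX ^ j

section Dynamics

variable {B : Type*} [NormedAddCommGroup B] [InnerProductSpace ℂ B]

/-- The tensor product `P ⊗ A` of a system operator and a bath operator. -/
def tensor (P : SysOp) (A : B →L[ℂ] B) : JointOp B :=
  Matrix.of fun i j => P i j • A

/-- The dephasing Hamiltonian `H = I ⊗ B_I + Z ⊗ B_Z`. -/
def dephasingHamiltonian (BI BZ : B →L[ℂ] B) : JointOp B :=
  tensor 1 BI + tensor pauliZ BZ

/-- The free evolution `exp(-i H τ)`. -/
def freeEvolution (H : JointOp B) (τ : ℝ) : JointOp B :=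
  NormedSpace.exp ((-(Complex.I * (τ : ℂ))) • H)

/-- A step of a control protocol: free evolution for a time `τ`, or an instantaneous pulse
applying the operator `P` to the system. -/
inductive Step : Type
  | free (τ : ℝ) : Step
  | pulse (P : SysOp) : Step

/-- The operator on system and bath that a step implements. -/
def Step.toOp (H : JointOp B) : Step → JointOp B
  | .free τ => freeEvolution H τ
  | .pulse P => tensor P 1

/-- The evolution generated by a protocol, whose steps are listed in chronological order. -/
def evolution (H : JointOp B) (s : List Step) : JointOp B :=
  s.foldl (fun U a => a.toOp H * U) 1

/-- The duration of a step. -/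
def Step.duration : Step → ℝ
  | .free τ => τ
  | .pulse _ => 0

/-- The total time of a protocol. -/
def totalTime (s : List Step) : ℝ := (s.map Step.duration).sum

open Classical in
/-- The number of pulses of a protocol (a pulse with operator `I` is no pulse). -/
def pulseCount (s : List Step) : ℕ :=
  s.countP fun a => decide (∃ P : SysOp, P ≠ 1 ∧ a = .pulse P)

/-- The `K`-pulse Uhrig sequence of total time `T` whose first and last pulse are modified by the
group element `g`, in chronological order:
the pulse `g_0† g†`, then free evolution on `[t_0, t_1]`, then for `j = 1, …, K` the pulse
`g_j† g_{j-1}` at `t_j` and free evolution on `[t_j, t_{j+1}]`, and finally the pulse `g g_K`.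
For `g = I` this is the deterministic sequence. -/
def uhrigSequence (K : ℕ) (T : ℝ) (g : SysOp) : List Step :=
  [.pulse ((toggle 0).conjTranspose * g.conjTranspose), .free (uhrigInterval K T 0)] ++
    (List.range K).flatMap (fun j =>
      [.pulse ((toggle (j + 1)).conjTranspose * toggle j), .free (uhrigInterval K T (j + 1))]) ++
    [.pulse (g * toggle K)]

variable [CompleteSpace B]

/-- The deterministic Uhrig protocol `D = ∏_{j = 0}^{K} g_j exp(-i H (t_{j+1} - t_j)) g_j†`, later
times standing on the left. -/
def uhrigDD (H : JointOp B) (K : ℕ) (T : ℝ) : JointOp B :=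
  (((List.range (K + 1)).reverse).map fun j =>
    tensor (toggle j) 1 * freeEvolution H (uhrigInterval K T j) *
      (tensor (toggle j) 1).conjTranspose).prod

/-- The deterministic protocol as a map on joint states, `ρ ↦ D ρ D†`. -/
def deterministic (D ρ : JointOp B) : JointOp B := D * ρ * D.conjTranspose

/-- The sequence-randomized protocol
`R(ρ) = (1 / |G|) ∑_{g ∈ G} (g D g†) ρ (g D† g†)`. -/
def randomized (G : Finset SysOp) (D ρ : JointOp B) : JointOp B :=
  ((G.card : ℂ)⁻¹) • ∑ g ∈ G,
    (tensor g 1 * D * (tensor g 1).conjTranspose) * ρ *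
      (tensor g 1 * D.conjTranspose * (tensor g 1).conjTranspose)

end Dynamics

section Bath

variable {B ι : Type*} [NormedAddCommGroup B] [InnerProductSpace ℂ B]

/-- The trace of a (trace class) operator on `B`, computed in a Hilbert basis. -/
def bathTrace (b : HilbertBasis ι ℂ B) (A : B →L[ℂ] B) : ℂ :=
  ∑' k, inner ℂ (b k) (A (b k))

/-- Density operators on `B`: positive operators of trace one. -/
def IsBathState (b : HilbertBasis ι ℂ B) (ρ : B →L[ℂ] B) : Prop :=
  ρ.IsPositive ∧ HasSum (fun k => inner ℂ (b k) (ρ (b k))) (1 : ℂ)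

/-- The partial trace over the bath. -/
def partialTrace (b : HilbertBasis ι ℂ B) (M : JointOp B) : SysOp :=
  Matrix.of fun i j => bathTrace b (M i j)

end Bath

end UDD

end

open Filter Topology

noncomputable section

namespace UDD

/-! ### Quasi-periodicity under translation by `π / N`. -/

section Floquet

open MeasureTheory

/-! `H` is diagonal in the eigenbasis of `Z`, so `D` is block diagonal, with unitary blocks `U`, `W`
evolving under `BI ± BZ` with alternating signs (`uhrigDD_eq_diagonal`). Populations are untouched
and each coherence is multiplied by a bath trace such as `tr (U ρ W†)`. Since `tr (U ρ U†) = 1`,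
this trace is within `‖U - W‖` of 1. Randomizing swaps `U` and `W` and averages; expanding `tr ((U -
W) ρ (U - W)†)` shows that the averaged factor deviates from 1 by at most `‖U - W‖ ^ 2`, which
doubles the order.

It remains to see that `‖U - W‖ = O(T ^ (K + 1))` (`exists_norm_branchPropagator_sub_le`). Put `t =
T / 2 * (1 - cos θ)` and `N = K + 1`: the Uhrig times become equidistant, the sign pattern becomes
`sign (sin (N θ))`, and `dt` carries a factor `sin θ`. The blocks differ by Dyson terms odd in the
coupling, and those of order below `N` vanish at `θ = π`. Indeed, terms of order `n` are sums of
functions multiplied by `± exp(i k π / N)`, `|k| ≤ n`, under translation by `π / N`, with sign `+`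
for even terms and `-` for odd ones (`dysonTerm_mem_floquetSpan`). Integration keeps this form:
secular growth is excluded by parity in the even case, and in the odd case by non-resonance, as
`-exp(i k π / N) ≠ 1` for `|k| < N`. So the odd terms are `2π`-periodic odd functions of `θ`, which
vanish at `π` (`dysonTerm_snd_pi`). Unitarity controls the truncation error
(`norm_branchSum_sub_le`). -/

/-- The switching function `sign (sin (N θ))`. -/
def switching (N : ℕ) (θ : ℝ) : ℝ := Real.sign (Real.sin (N * θ))

lemma measurable_sign_real : Measurable Real.sign := by
  unfold Real.sign
  exact Measurable.ite measurableSet_Iio measurable_const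
    (Measurable.ite measurableSet_Ioi measurable_const measurable_const)

lemma measurable_switching (N : ℕ) : Measurable (switching N) :=
  measurable_sign_real.comp (Real.measurable_sin.comp (measurable_const_mul _))

lemma norm_switching_le (N : ℕ) (θ : ℝ) : ‖(switching N θ : ℂ)‖ ≤ 1 := by
  unfold switching
  rcases Real.sign_apply_eq (Real.sin (N * θ)) with h | h | h <;> simp [h]

lemma switching_neg (N : ℕ) (θ : ℝ) : switching N (-θ) = -switching N θ := by
  simp [switching, Real.sign_neg]

lemma switching_add {N : ℕ} (hN : N ≠ 0) (θ : ℝ) :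
    switching N (θ + Real.pi / N) = -switching N θ := by
  have h : (N : ℝ) * (θ + Real.pi / N) = N * θ + Real.pi := by
    have : (N : ℝ) ≠ 0 := by exact_mod_cast hN
    field_simp
  simp [switching, h, Real.sin_add_pi, Real.sign_neg]

lemma switching_eq_neg_one_pow {N : ℕ} (hN : N ≠ 0) (j : ℕ) {θ : ℝ}
    (h : θ ∈ Set.Ioo (j * (Real.pi / N)) ((j + 1) * (Real.pi / N))) :
    switching N θ = (-1) ^ j := by
  induction j generalizing θ with
  | zero =>
    have hN' : (0 : ℝ) < N := by positivity
    have h1 : 0 < θ := by simpa using h.1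
    have h2 : θ < Real.pi / N := by simpa using h.2
    have h3 : N * θ < Real.pi := by rw [lt_div_iff₀ hN'] at h2; linarith
    simp [switching, Real.sign_of_pos (Real.sin_pos_of_pos_of_lt_pi (by positivity) h3)]
  | succ j ih =>
    have h' := h
    obtain ⟨h1, h2⟩ := h
    push_cast at h1 h2
    have := ih (θ := θ - Real.pi / N) ⟨by linarith, by linarith⟩
    rw [show θ = θ - Real.pi / N + Real.pi / N by ring, switching_add hN, this, pow_succ]
    ring

variable {V : Type*} [NormedAddCommGroup V] [NormedSpace ℂ V]

/-- Spans of locally integrable functions that are multiplied by `ε exp(i k π / N)`, `|k| ≤ n`,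
under translation by `π / N`. -/
def floquetSpan (V : Type*) [NormedAddCommGroup V] [NormedSpace ℂ V] (N n : ℕ) (ε : ℂ) :
    Submodule ℂ (ℝ → V) :=
  Submodule.span ℂ {g | (∀ a b, IntervalIntegrable g volume a b) ∧ ∃ k : ℤ, |k| ≤ n ∧
    ∀ θ, g (θ + Real.pi / N) = (ε * Complex.exp (Complex.I * (k * (Real.pi / N)))) • g θ}

variable {N n : ℕ} {ε : ℂ} {g : ℝ → V}

lemma intervalIntegrable_of_mem_floquetSpan (hg : g ∈ floquetSpan V N n ε) (a b : ℝ) :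
    IntervalIntegrable g volume a b := by
  induction hg using Submodule.span_induction with
  | mem g h => exact h.1 a b
  | zero => exact IntervalIntegrable.zero
  | add f g _ _ hf hg => exact hf.add hg
  | smul c g _ hg => exact hg.smul c

/-- A full period consists of `2N` translations, and `(ε exp(i k π / N)) ^ (2N) = 1`. -/
lemma periodic_of_mem_floquetSpan (hN : N ≠ 0) (hε : ε ^ 2 = 1) (hg : g ∈ floquetSpan V N n ε)
    (θ : ℝ) : g (θ + 2 * Real.pi) = g θ := by
  have hN' : (N : ℝ) ≠ 0 := by exact_mod_cast hN
  induction hg using Submodule.span_induction with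
  | mem g h =>
    obtain ⟨-, k, -, h⟩ := h
    have key : ∀ m : ℕ, g (θ + m * (Real.pi / N)) =
        (ε * Complex.exp (Complex.I * (k * (Real.pi / N)))) ^ m • g θ := by
      intro m
      induction m with
      | zero => simp
      | succ m ih =>
        rw [show θ + ((m + 1 : ℕ) : ℝ) * (Real.pi / N) = θ + m * (Real.pi / N) + Real.pi / N by
          push_cast; ring, h, ih, smul_smul, pow_succ']
    have h2 := key (2 * N)
    rw [show θ + ((2 * N : ℕ) : ℝ) * (Real.pi / N) = θ + 2 * Real.pi by
      push_cast; field_simp] at h2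
    rw [h2, mul_pow, pow_mul, hε, one_pow, one_mul, ← Complex.exp_nat_mul]
    have : ((2 * N : ℕ) : ℂ) * (Complex.I * (k * (Real.pi / N))) =
        k * (2 * Real.pi * Complex.I) := by
      have : (N : ℂ) ≠ 0 := by exact_mod_cast hN
      push_cast; field_simp
    rw [this, Complex.exp_int_mul_two_pi_mul_I, one_smul]
  | zero => rfl
  | add f g _ _ hf hg => simp [hf, hg]
  | smul c g _ hg => simp [hg]

lemma comp_neg_mem_floquetSpan (hε : ε ^ 2 = 1) (hg : g ∈ floquetSpan V N n ε) :
    (fun θ => g (-θ)) ∈ floquetSpan V N n ε := by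
  induction hg using Submodule.span_induction with
  | mem g h =>
    obtain ⟨h1, k, hk, h⟩ := h
    refine Submodule.subset_span ⟨fun a b => ?_, -k, by simpa using hk, fun θ => ?_⟩
    · have := (h1 (-a) (-b)).comp_mul_left (c := -1)
      simpa using this
    · have h3 := h (-(θ + Real.pi / N))
      rw [show -(θ + Real.pi / N) + Real.pi / N = -θ by ring] at h3
      beta_reduce
      rw [h3, smul_smul]
      have : Complex.exp (Complex.I * (((-k : ℤ) : ℂ) * (Real.pi / N))) *
          Complex.exp (Complex.I * (k * (Real.pi / N))) = 1 := by
        rw [← Complex.exp_add]; simp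
      rw [show ε * Complex.exp (Complex.I * (((-k : ℤ) : ℂ) * (Real.pi / N))) *
        (ε * Complex.exp (Complex.I * (k * (Real.pi / N)))) = ε ^ 2 *
        (Complex.exp (Complex.I * (((-k : ℤ) : ℂ) * (Real.pi / N))) *
          Complex.exp (Complex.I * (k * (Real.pi / N)))) by ring, this, hε]
      simp
  | zero => exact Submodule.zero_mem _
  | add f g _ _ hf hg => exact Submodule.add_mem _ hf hg
  | smul c g _ hg => exact Submodule.smul_mem _ c hg

lemma cexp_smul_mem_floquetSpan {s : ℤ} (hs : |s| ≤ 1) (hg : g ∈ floquetSpan V N n ε) :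
    (fun θ : ℝ => Complex.exp (Complex.I * (s * θ)) • g θ) ∈ floquetSpan V N (n + 1) ε := by
  induction hg using Submodule.span_induction with
  | mem g h =>
    obtain ⟨h1, k, hk, h⟩ := h
    refine Submodule.subset_span ⟨fun a b => ?_, s + k, ?_, fun θ => ?_⟩
    · exact (h1 a b).continuousOn_smul (by fun_prop)
    · push_cast
      exact (abs_add_le s k).trans (by linarith)
    · beta_reduce
      rw [h, smul_smul, smul_smul]
      congr 1
      push_cast
      rw [mul_left_comm, mul_assoc ε, mul_comm (Complex.exp (Complex.I * ((s + k) * _))),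
        ← Complex.exp_add, ← Complex.exp_add]
      ring_nf
  | zero =>
    simp only [Pi.zero_apply, smul_zero]
    exact Submodule.zero_mem _
  | add f g _ _ hf hg => simpa using! Submodule.add_mem _ hf hg
  | smul c g _ hg =>
    convert Submodule.smul_mem _ c hg using 1
    ext θ
    simp [smul_comm c]

lemma sin_smul_mem_floquetSpan (hg : g ∈ floquetSpan V N n ε) :
    (fun θ : ℝ => (Real.sin θ : ℂ) • g θ) ∈ floquetSpan V N (n + 1) ε := by
  have h1 := cexp_smul_mem_floquetSpan (s := -1) (by simp) hg
  have h2 := cexp_smul_mem_floquetSpan (s := 1) (by simp) hg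
  convert Submodule.smul_mem _ (Complex.I / 2) (Submodule.sub_mem _ h1 h2) using 1
  ext θ
  simp only [Pi.smul_apply, Pi.sub_apply, ← sub_smul, smul_smul]
  congr 1
  rw [Complex.ofReal_sin, Complex.sin]
  push_cast
  ring_nf

/-- The switching function changes sign under translation by `π / N`; thus it flips `ε` without
enlarging the range of `k`. -/
lemma switching_smul_mem_floquetSpan (hN : N ≠ 0) (hg : g ∈ floquetSpan V N n ε) :
    (fun θ : ℝ => (switching N θ : ℂ) • g θ) ∈ floquetSpan V N n (-ε) := by
  induction hg using Submodule.span_induction with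
  | mem g h =>
    obtain ⟨h1, k, hk, h⟩ := h
    refine Submodule.subset_span ⟨fun a b => ?_, k, hk, fun θ => ?_⟩
    · rw [intervalIntegrable_iff]
      exact (intervalIntegrable_iff.1 (h1 a b)).bdd_smul 1
        (Complex.measurable_ofReal.comp (measurable_switching N)).aestronglyMeasurable
        (Eventually.of_forall (norm_switching_le N))
    · beta_reduce
      rw [h, smul_smul, smul_smul, switching_add hN]
      push_cast
      ring_nf
  | zero =>
    simp only [Pi.zero_apply, smul_zero]
    exact Submodule.zero_mem _
  | add f g _ _ hf hg => simpa using! Submodule.add_mem _ hf hg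
  | smul c g _ hg =>
    convert Submodule.smul_mem _ c hg using 1
    ext θ
    simp [smul_comm c]

lemma clm_comp_mem_floquetSpan (L : V →L[ℂ] V) (hg : g ∈ floquetSpan V N n ε) :
    (fun θ => L (g θ)) ∈ floquetSpan V N n ε := by
  induction hg using Submodule.span_induction with
  | mem g h =>
    obtain ⟨h1, k, hk, h⟩ := h
    refine Submodule.subset_span ⟨fun a b => ?_, k, hk, fun θ => ?_⟩
    · exact ⟨L.integrable_comp (h1 a b).1, L.integrable_comp (h1 a b).2⟩
    · beta_reduce
      rw [h, map_smul]
  | zero =>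
    simp only [Pi.zero_apply, map_zero]
    exact Submodule.zero_mem _
  | add f g _ _ hf hg => simpa using! Submodule.add_mem _ hf hg
  | smul c g _ hg => simpa using! Submodule.smul_mem _ c hg

lemma const_mem_floquetSpan (v : V) : (fun _ => v) ∈ floquetSpan V N n 1 :=
  Submodule.subset_span ⟨fun _ _ => intervalIntegrable_const, 0, by simp, by simp⟩

lemma primitive_neg (g : ℝ → V) (θ : ℝ) :
    ∫ φ in (0 : ℝ)..(-θ), g φ = -∫ φ in (0 : ℝ)..θ, g (-φ) := by
  rw [intervalIntegral.integral_comp_neg, neg_zero, intervalIntegral.integral_symm]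

/-- A primitive of a function in the Floquet span is in it up to an affine function, which is
constant if no generator is translation invariant. -/
lemma exists_primitive_eq (hN : N ≠ 0) (hg : g ∈ floquetSpan V N n ε) :
    ∃ Q ∈ floquetSpan V N n ε, ∃ c d : V, (∀ θ, ∫ φ in (0 : ℝ)..θ, g φ = Q θ + c + (θ : ℂ) • d) ∧
      ((∀ k : ℤ, |k| ≤ n → ε * Complex.exp (Complex.I * (k * (Real.pi / N))) ≠ 1) → d = 0) := by
  have hτ : ((Real.pi / N : ℝ) : ℂ) ≠ 0 := by
    have : (N : ℝ) ≠ 0 := by exact_mod_cast hN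
    exact_mod_cast div_ne_zero Real.pi_ne_zero this
  induction hg using Submodule.span_induction with
  | mem g h =>
    obtain ⟨h1, k, hk, h⟩ := h
    set μ := ε * Complex.exp (Complex.I * (k * (Real.pi / N))) with hμ
    set G : ℝ → V := fun θ => ∫ φ in (0 : ℝ)..θ, g φ with hG
    have hGc : Continuous G := intervalIntegral.continuous_primitive h1 0
    have hGτ : ∀ θ, G (θ + Real.pi / N) = G (Real.pi / N) + μ • G θ := by
      intro θ
      have e1 : (∫ φ in (0 : ℝ)..θ, g (φ + Real.pi / N)) = μ • G θ := by
        simp only [h, hG, intervalIntegral.integral_smul]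
      rw [intervalIntegral.integral_comp_add_right, zero_add] at e1
      rw [← e1]
      exact (intervalIntegral.integral_add_adjacent_intervals (h1 _ _) (h1 _ _)).symm
    -- Resonant case: the primitive gains a fixed increment per translation, removed by a linear
    -- function. Otherwise that increment is absorbed by a constant shift.
    by_cases h1μ : μ = 1
    · set d : V := (((Real.pi / N : ℝ) : ℂ)⁻¹) • G (Real.pi / N) with hd
      refine ⟨fun θ => G θ - (θ : ℂ) • d, Submodule.subset_span ⟨fun a b => ?_, k, hk, fun θ => ?_⟩,
        0, d, fun θ => by simp [hG], fun hne => absurd h1μ (hne k hk)⟩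
      · exact Continuous.intervalIntegrable (by fun_prop) a b
      · beta_reduce
        rw [← hμ, hGτ, h1μ, one_smul, one_smul, Complex.ofReal_add, add_smul, hd, smul_smul,
          smul_smul, mul_inv_cancel₀ hτ, one_smul]
        abel
    · have hμ1 : μ - 1 ≠ 0 := sub_ne_zero.2 h1μ
      set c : V := (μ - 1)⁻¹ • G (Real.pi / N) with hc
      refine ⟨fun θ => G θ + c, Submodule.subset_span ⟨fun a b => ?_, k, hk, fun θ => ?_⟩,
        -c, 0, fun θ => by simp [hG], fun _ => rfl⟩
      · exact Continuous.intervalIntegrable (by fun_prop) a b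
      · have : G (Real.pi / N) = (μ - 1) • c := by rw [hc, smul_smul, mul_inv_cancel₀ hμ1, one_smul]
        beta_reduce
        rw [← hμ, hGτ, this]
        module
  | zero => exact ⟨0, Submodule.zero_mem _, 0, 0, by simp, fun _ => rfl⟩
  | add f g hf' hg' hf hg =>
    obtain ⟨Q, hQ, c, d, h, hd⟩ := hf
    obtain ⟨Q', hQ', c', d', h', hd'⟩ := hg
    refine ⟨Q + Q', Submodule.add_mem _ hQ hQ', c + c', d + d', fun θ => ?_, fun hne => ?_⟩
    · simp only [Pi.add_apply]
      rw [intervalIntegral.integral_add (intervalIntegrable_of_mem_floquetSpan hf' _ _)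
        (intervalIntegrable_of_mem_floquetSpan hg' _ _), h, h']
      module
    · rw [hd hne, hd' hne, add_zero]
  | smul a g _ hg =>
    obtain ⟨Q, hQ, c, d, h, hd⟩ := hg
    refine ⟨a • Q, Submodule.smul_mem _ a hQ, a • c, a • d, fun θ => ?_, fun hne => ?_⟩
    · simp only [Pi.smul_apply, intervalIntegral.integral_smul, h]
      module
    · rw [hd hne, smul_zero]

/-- The primitive is even, so symmetrizing removes the linear term; the remaining constant is
admissible for `ε = 1`. -/
lemma primitive_even_mem_floquetSpan (hN : N ≠ 0) (hg : g ∈ floquetSpan V N n 1)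
    (hodd : ∀ θ, g (-θ) = -g θ) :
    (fun θ => ∫ φ in (0 : ℝ)..θ, g φ) ∈ floquetSpan V N n 1 := by
  obtain ⟨Q, hQ, c, d, h, -⟩ := exists_primitive_eq hN hg
  have hev : ∀ θ, ∫ φ in (0 : ℝ)..θ, g φ = Q (-θ) + c - (θ : ℂ) • d := by
    intro θ
    have := h (-θ)
    rw [primitive_neg] at this
    simp only [hodd, intervalIntegral.integral_neg, neg_neg, Complex.ofReal_neg, neg_smul] at this
    rw [this, sub_eq_add_neg]
  have hm := Submodule.add_mem _ (Submodule.smul_mem _ (1 / 2 : ℂ) (Submodule.add_mem _ hQ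
    (comp_neg_mem_floquetSpan (by norm_num) hQ))) (const_mem_floquetSpan (N := N) (n := n) c)
  convert hm using 1
  ext θ
  have e : ∫ φ in (0 : ℝ)..θ, g φ = (1 / 2 : ℂ) • ((∫ φ in (0 : ℝ)..θ, g φ) +
    ∫ φ in (0 : ℝ)..θ, g φ) := by module
  rw [e]
  nth_rewrite 1 [h]
  rw [hev]
  simp only [Pi.add_apply, Pi.smul_apply]
  module

/-- Non-resonance removes the linear term, and antisymmetrizing removes the constant. -/
lemma primitive_odd_mem_floquetSpan (hn : n < N) (hg : g ∈ floquetSpan V N n (-1))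
    (heven : ∀ θ, g (-θ) = g θ) :
    (fun θ => ∫ φ in (0 : ℝ)..θ, g φ) ∈ floquetSpan V N n (-1) := by
  have hN : N ≠ 0 := by omega
  obtain ⟨Q, hQ, c, d, h, hd⟩ := exists_primitive_eq hN hg
  have hd0 : d = 0 := by
    refine hd fun k hk h1 => ?_
    have h2 : Complex.exp (Complex.I * (k * (Real.pi / N)) - Real.pi * Complex.I) = 1 := by
      rw [Complex.exp_sub, Complex.exp_pi_mul_I]
      linear_combination h1
    obtain ⟨m, hm⟩ := Complex.exp_eq_one_iff.1 h2
    have hNC : (N : ℂ) ≠ 0 := by exact_mod_cast hN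
    have hpi : (Real.pi : ℂ) ≠ 0 := by exact_mod_cast Real.pi_ne_zero
    -- A resonance would make `k` an odd multiple of `N`, impossible for `|k| < N`.
    have h3 : (k : ℂ) = N * (2 * m + 1) := by
      have hI := Complex.I_ne_zero
      field_simp at hm
      linear_combination hm
    have h4 : k = N * (2 * m + 1) := by exact_mod_cast h3
    have h5 : (N : ℤ) ∣ k := ⟨_, h4⟩
    have h6 : k = 0 := Int.eq_zero_of_abs_lt_dvd h5 (by omega)
    rw [h6] at h4
    rcases mul_eq_zero.1 h4.symm with h7 | h7 <;> omega
  subst hd0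
  have hev : ∀ θ, ∫ φ in (0 : ℝ)..θ, g φ = -(Q (-θ) + c) := by
    intro θ
    have := h (-θ)
    rw [primitive_neg] at this
    simp only [heven, smul_zero, add_zero] at this
    rw [← this, neg_neg]
  have hm := Submodule.smul_mem _ (1 / 2 : ℂ) (Submodule.sub_mem _ hQ
    (comp_neg_mem_floquetSpan (by norm_num) hQ))
  convert hm using 1
  ext θ
  have e : ∫ φ in (0 : ℝ)..θ, g φ = (1 / 2 : ℂ) • ((∫ φ in (0 : ℝ)..θ, g φ) +
    ∫ φ in (0 : ℝ)..θ, g φ) := by module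
  rw [e]
  nth_rewrite 1 [h]
  rw [hev]
  simp only [Pi.sub_apply, Pi.smul_apply]
  module

end Floquet

/-! ### Dyson terms in the angle variable and the truncation error. -/

section Dyson

open MeasureTheory

variable {𝔸 : Type*} [NormedRing 𝔸] [NormedAlgebra ℂ 𝔸]

/-- The Dyson terms of `U' = sin θ (A + F C) U`, with `F` the switching function, in the angle
variable, split into the parts even and odd in `C`. -/
def dysonTerm (N : ℕ) (A C : 𝔸) : ℕ → (ℝ → 𝔸) × (ℝ → 𝔸)
  | 0 => (fun _ => 1, fun _ => 0)
  | n + 1 =>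
    (fun θ => ∫ φ in (0 : ℝ)..θ, (Real.sin φ : ℂ) •
      (A * (dysonTerm N A C n).1 φ + (switching N φ : ℂ) • (C * (dysonTerm N A C n).2 φ)),
    fun θ => ∫ φ in (0 : ℝ)..θ, (Real.sin φ : ℂ) •
      (A * (dysonTerm N A C n).2 φ + (switching N φ : ℂ) • (C * (dysonTerm N A C n).1 φ)))

lemma mul_add_switching_mem_floquetSpan {N n : ℕ} (hN : N ≠ 0) {ε : ℂ} (A C : 𝔸) {f g : ℝ → 𝔸}
    (hf : f ∈ floquetSpan 𝔸 N n ε) (hg : g ∈ floquetSpan 𝔸 N n (-ε)) :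
    (fun φ => (Real.sin φ : ℂ) • (A * f φ + (switching N φ : ℂ) • (C * g φ))) ∈
      floquetSpan 𝔸 N (n + 1) ε := by
  have h1 := clm_comp_mem_floquetSpan (ContinuousLinearMap.mul ℂ 𝔸 A) hf
  have h2 := switching_smul_mem_floquetSpan hN
    (clm_comp_mem_floquetSpan (ContinuousLinearMap.mul ℂ 𝔸 C) hg)
  rw [neg_neg] at h2
  exact sin_smul_mem_floquetSpan (Submodule.add_mem _ h1 h2)

lemma dysonTerm_symmetry (N : ℕ) (A C : 𝔸) (n : ℕ) :
    (∀ θ, (dysonTerm N A C n).1 (-θ) = (dysonTerm N A C n).1 θ) ∧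
    ∀ θ, (dysonTerm N A C n).2 (-θ) = -(dysonTerm N A C n).2 θ := by
  induction n with
  | zero => simp [dysonTerm]
  | succ n ih =>
    constructor <;> intro θ <;> simp only [dysonTerm] <;> rw [primitive_neg]
    · simp [ih.1, ih.2, switching_neg, -smul_add]
    · congr 1
      refine intervalIntegral.integral_congr fun φ _ => ?_
      simp only [ih.1, ih.2, switching_neg, Real.sin_neg]
      push_cast
      simp only [mul_neg, neg_smul]
      module

lemma dysonTerm_mem_floquetSpan {N n : ℕ} (A C : 𝔸) (hn : n < N) :
    (dysonTerm N A C n).1 ∈ floquetSpan 𝔸 N n 1 ∧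
    (dysonTerm N A C n).2 ∈ floquetSpan 𝔸 N n (-1) := by
  induction n with
  | zero => exact ⟨const_mem_floquetSpan 1, Submodule.zero_mem _⟩
  | succ n ih =>
    have ih := ih (by omega)
    obtain ⟨hs, hs'⟩ := dysonTerm_symmetry N A C n
    refine ⟨primitive_even_mem_floquetSpan (by omega)
      (mul_add_switching_mem_floquetSpan (by omega) A C ih.1 ih.2) fun θ => ?_,
      primitive_odd_mem_floquetSpan hn
      (mul_add_switching_mem_floquetSpan (by omega) A C ih.2 (by simpa using ih.1)) fun θ => ?_⟩
    · simp [hs, hs', switching_neg, -smul_add]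
    · simp only [hs, hs', switching_neg, Real.sin_neg]
      push_cast
      simp only [mul_neg, neg_smul]
      module

lemma continuous_dysonTerm {N n : ℕ} (A C : 𝔸) (hn : n < N) :
    Continuous (dysonTerm N A C n).1 ∧ Continuous (dysonTerm N A C n).2 := by
  cases n with
  | zero => exact ⟨continuous_const, continuous_const⟩
  | succ n =>
    have ih := dysonTerm_mem_floquetSpan A C (show n < N by omega)
    exact ⟨intervalIntegral.continuous_primitive (fun a b => intervalIntegrable_of_mem_floquetSpan
        (mul_add_switching_mem_floquetSpan (by omega) A C ih.1 ih.2) a b) 0,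
      intervalIntegral.continuous_primitive (fun a b => intervalIntegrable_of_mem_floquetSpan
        (mul_add_switching_mem_floquetSpan (by omega) A C ih.2 (by simpa using ih.1)) a b) 0⟩

/-- The odd Dyson terms of order below `N` vanish at the final time. -/
lemma dysonTerm_snd_pi {N n : ℕ} (A C : 𝔸) (hn : n < N) : (dysonTerm N A C n).2 Real.pi = 0 := by
  -- Oddness and `2π`-periodicity make the value at `π` its own negative.
  have h1 := periodic_of_mem_floquetSpan (by omega) (by norm_num)
    (dysonTerm_mem_floquetSpan A C hn).2 (-Real.pi)
  rw [(dysonTerm_symmetry N A C n).2, show -Real.pi + 2 * Real.pi = Real.pi by ring] at h1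
  have h2 : (2 : ℂ) • (dysonTerm N A C n).2 Real.pi = 0 := by
    rw [two_smul]
    nth_rewrite 1 [h1]
    exact neg_add_cancel _
  exact (smul_eq_zero.1 h2).resolve_left two_ne_zero

/-- The Dyson term for the coupling `σ C`, `σ = ± 1`. -/
def branchTerm (N : ℕ) (A C : 𝔸) (σ : ℂ) (n : ℕ) (θ : ℝ) : 𝔸 :=
  (dysonTerm N A C n).1 θ + σ • (dysonTerm N A C n).2 θ

lemma continuous_branchTerm {N n : ℕ} (A C : 𝔸) (σ : ℂ) (hn : n < N) :
    Continuous (branchTerm N A C σ n) :=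
  (continuous_dysonTerm A C hn).1.add ((continuous_dysonTerm A C hn).2.const_smul σ)

/-- The even and odd recursions recombine into one because `σ ^ 2 = 1`, and the generator is
constant between consecutive switching angles. -/
lemma branchTerm_succ {N n : ℕ} (A C : 𝔸) {σ : ℂ} (hσ : σ ^ 2 = 1) (hn : n < N) (j : ℕ) {θ : ℝ}
    (hθ : θ ∈ Set.Icc (j * (Real.pi / N)) ((j + 1) * (Real.pi / N))) :
    branchTerm N A C σ (n + 1) θ = branchTerm N A C σ (n + 1) (j * (Real.pi / N)) +
      ∫ φ in (j * (Real.pi / N))..θ, (Real.sin φ : ℂ) •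
        ((A + (σ * (-1) ^ j) • C) * branchTerm N A C σ n φ) := by
  have ih := dysonTerm_mem_floquetSpan A C hn
  have i1 := intervalIntegrable_of_mem_floquetSpan
    (mul_add_switching_mem_floquetSpan (by omega) A C ih.1 ih.2)
  have i2 := intervalIntegrable_of_mem_floquetSpan
    (mul_add_switching_mem_floquetSpan (by omega) A C ih.2 (by simpa using ih.1))
  have e : branchTerm N A C σ (n + 1) = fun θ => ∫ φ in (0 : ℝ)..θ, ((Real.sin φ : ℂ) •
      (A * (dysonTerm N A C n).1 φ + (switching N φ : ℂ) • (C * (dysonTerm N A C n).2 φ)) +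
      σ • ((Real.sin φ : ℂ) •
      (A * (dysonTerm N A C n).2 φ + (switching N φ : ℂ) • (C * (dysonTerm N A C n).1 φ)))) := by
    ext θ
    have := intervalIntegral.integral_add (i1 0 θ) ((i2 0 θ).smul σ)
    simp only [Pi.smul_apply] at this
    rw [this, intervalIntegral.integral_smul]
    rfl
  have hint := fun a b => (i1 a b).add ((i2 a b).smul σ)
  simp only [Pi.smul_apply] at hint
  rw [e]
  beta_reduce
  rw [← intervalIntegral.integral_add_adjacent_intervals (hint 0 (j * (Real.pi / N))) (hint _ θ)]
  congr 1
  refine intervalIntegral.integral_congr_Ioo_of_le hθ.1 fun φ hφ => ?_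
  have hs := switching_eq_neg_one_pow (N := N) (by omega) j ⟨hφ.1, hφ.2.trans_le hθ.2⟩
  simp only [hs, branchTerm, add_mul, mul_add, smul_mul_assoc, mul_smul_comm, smul_add, smul_smul]
  push_cast
  rw [show Complex.sin φ * (σ * (σ * (-1) ^ j)) = Complex.sin φ * (-1) ^ j by
    linear_combination Complex.sin φ * (-1) ^ j * hσ]
  module

variable [CompleteSpace 𝔸]

/-- In the interaction picture of the exact evolution, all contributions to the derivative of the
truncated series telescope except the one of top order, `l ^ N`; the mean value inequality bounds
the drift. -/
lemma norm_branchSum_sub_le {N : ℕ} (hN : N ≠ 0) (A C : 𝔸) {σ : ℂ} (hσ : σ ^ 2 = 1) (j : ℕ)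
    (l : ℂ) (hexp : ∀ r : ℝ, ‖NormedSpace.exp (r • l • (A + (σ * (-1) ^ j) • C))‖ ≤ 1) {R : ℝ}
    (hR : ∀ θ ∈ Set.Icc (j * (Real.pi / N)) ((j + 1) * (Real.pi / N)),
      ‖branchTerm N A C σ (N - 1) θ‖ ≤ R) :
    ‖(∑ n ∈ Finset.range N, l ^ n • branchTerm N A C σ n ((j + 1) * (Real.pi / N))) -
      NormedSpace.exp ((Real.cos (j * (Real.pi / N)) - Real.cos ((j + 1) * (Real.pi / N))) •
        l • (A + (σ * (-1) ^ j) • C)) *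
      ∑ n ∈ Finset.range N, l ^ n • branchTerm N A C σ n (j * (Real.pi / N))‖ ≤
    ‖A + (σ * (-1) ^ j) • C‖ * R * (Real.pi / N) * ‖l‖ ^ N := by
  obtain ⟨K, rfl⟩ := Nat.exists_eq_succ_of_ne_zero hN
  set M := A + (σ * (-1) ^ j) • C with hM
  set a := (j : ℝ) * (Real.pi / (K + 1 : ℕ)) with ha
  set b := ((j : ℝ) + 1) * (Real.pi / (K + 1 : ℕ)) with hb
  have hpos : 0 < Real.pi / (K + 1 : ℕ) := by positivity
  have hba : b - a = Real.pi / (K + 1 : ℕ) := by rw [ha, hb]; ring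
  have hab : a ≤ b := by linarith
  set X := l • M with hX
  let W := branchTerm (K + 1) A C σ
  let P : ℝ → 𝔸 := fun θ => ∑ n ∈ Finset.range (K + 1), l ^ n • W n θ
  -- The exponential is the inverse of the exact propagator from `a` to `θ`, so `Y` would be
  -- constant if `P` solved the equation exactly.
  let Y : ℝ → 𝔸 := fun θ => NormedSpace.exp ((Real.cos θ - Real.cos a) • X) * P θ
  have hW : ∀ n < K, ∀ θ ∈ Set.Icc a b, HasDerivWithinAt (W (n + 1))
      ((Real.sin θ : ℂ) • (M * W n θ)) (Set.Icc a b) θ := by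
    intro n hn θ hθ
    have hc : Continuous fun φ => (Real.sin φ : ℂ) • (M * W n φ) := by
      have := continuous_branchTerm (N := K + 1) A C σ (show n < K + 1 by omega)
      fun_prop
    have h1 : HasDerivAt (fun θ => W (n + 1) a + ∫ φ in a..θ, (Real.sin φ : ℂ) • (M * W n φ))
        ((Real.sin θ : ℂ) • (M * W n θ)) θ :=
      (hc.integral_hasStrictDerivAt a θ).hasDerivAt.const_add _
    exact h1.hasDerivWithinAt.congr
      (fun x hx => branchTerm_succ A C hσ (by omega) j hx)
      (branchTerm_succ A C hσ (by omega) j hθ)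
  have hP : ∀ θ ∈ Set.Icc a b, HasDerivWithinAt P
      (Real.sin θ • (X * ∑ n ∈ Finset.range K, l ^ n • W n θ)) (Set.Icc a b) θ := by
    intro θ hθ
    have h0 : HasDerivWithinAt (fun θ => l ^ 0 • W 0 θ) 0 (Set.Icc a b) θ := by
      have : (fun θ => l ^ 0 • W 0 θ) = fun _ => (1 : 𝔸) := by
        ext θ; simp [W, branchTerm, dysonTerm]
      rw [this]
      exact hasDerivWithinAt_const _ _ _
    have h1 := (HasDerivWithinAt.fun_sum (u := Finset.range K) fun n hn =>
      (hW n (Finset.mem_range.1 hn) θ hθ).const_smul (l ^ (n + 1))).add h0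
    convert! h1 using 1
    · ext θ
      simp only [Pi.add_apply, Pi.smul_apply]
      exact Finset.sum_range_succ' _ _
    · rw [add_zero, Finset.mul_sum, Finset.smul_sum]
      refine Finset.sum_congr rfl fun n _ => ?_
      rw [hX, ← Complex.coe_smul]
      simp only [smul_mul_assoc, mul_smul_comm, smul_smul]
      ring_nf
  have hE : ∀ θ, HasDerivAt (fun θ => NormedSpace.exp ((Real.cos θ - Real.cos a) • X))
      ((-Real.sin θ) • (NormedSpace.exp ((Real.cos θ - Real.cos a) • X) * X)) θ := by
    intro θ
    exact (hasDerivAt_exp_smul_const X (Real.cos θ - Real.cos a)).scomp θ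
      ((Real.hasDerivAt_cos θ).sub_const _)
  have hY : ∀ θ ∈ Set.Icc a b, HasDerivWithinAt Y
      (-(Real.sin θ • (NormedSpace.exp ((Real.cos θ - Real.cos a) • X) * (X *
        l ^ K • W K θ)))) (Set.Icc a b) θ := by
    intro θ hθ
    convert! (hE θ).hasDerivWithinAt.mul (hP θ hθ) using 1
    simp only [P, Finset.sum_range_succ, mul_add, neg_smul, neg_mul, smul_mul_assoc,
      mul_smul_comm, mul_assoc]
    module
  have hbound : ∀ θ ∈ Set.Ico a b, ‖-(Real.sin θ • (NormedSpace.exp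
      ((Real.cos θ - Real.cos a) • X) * (X * l ^ K • W K θ)))‖ ≤ ‖M‖ * R * ‖l‖ ^ (K + 1) := by
    intro θ hθ
    have hR' : ‖W K θ‖ ≤ R := hR θ (Set.Ico_subset_Icc_self hθ)
    rw [norm_neg, norm_smul, Real.norm_eq_abs]
    calc |Real.sin θ| * ‖NormedSpace.exp ((Real.cos θ - Real.cos a) • X) * (X * l ^ K • W K θ)‖
        ≤ 1 * (1 * ((‖l‖ * ‖M‖) * (‖l‖ ^ K * R))) := by
          gcongr
          · exact Real.abs_sin_le_one θ
          · refine (norm_mul_le _ _).trans ?_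
            gcongr
            · exact hexp _
            · refine (norm_mul_le _ _).trans ?_
              gcongr
              · exact norm_smul_le _ _
              · rw [norm_smul, norm_pow]
                gcongr
      _ = ‖M‖ * R * ‖l‖ ^ (K + 1) := by ring
  have hfin := norm_image_sub_le_of_norm_deriv_le_segment' hY hbound b (Set.right_mem_Icc.2 hab)
  have hinv : NormedSpace.exp ((Real.cos a - Real.cos b) • X) *
      NormedSpace.exp ((Real.cos b - Real.cos a) • X) = 1 := by
    let _ : NormedAlgebra ℚ 𝔸 := NormedAlgebra.restrictScalars ℚ ℂ 𝔸
    rw [← NormedSpace.exp_add_of_commute]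
    · rw [← add_smul]; simp
    · exact ((Commute.refl X).smul_left _).smul_right _
  have key : P b - NormedSpace.exp ((Real.cos a - Real.cos b) • X) * P a =
      NormedSpace.exp ((Real.cos a - Real.cos b) • X) * (Y b - Y a) := by
    simp only [Y, mul_sub, ← mul_assoc, hinv]
    simp
  change ‖P b - NormedSpace.exp ((Real.cos a - Real.cos b) • X) * P a‖ ≤ _
  rw [key]
  calc _ ≤ 1 * ‖Y b - Y a‖ := (norm_mul_le _ _).trans (by gcongr; exact hexp _)
    _ ≤ ‖M‖ * R * ‖l‖ ^ (K + 1) * (b - a) := by rw [one_mul]; exact hfin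
    _ = _ := by rw [hba]; simp only [Nat.succ_eq_add_one]; ring

end Dyson

/-! ### The two unitary branches and their difference. -/

section Branches

variable {𝔸 : Type*} [CStarAlgebra 𝔸]

lemma exp_neg_I_smul_mem_unitary {H : 𝔸} (hH : IsSelfAdjoint H) (r : ℝ) :
    NormedSpace.exp ((-(Complex.I * (r : ℂ))) • H) ∈ unitary 𝔸 := by
  have h : IsSelfAdjoint ((-r) • H) := (IsSelfAdjoint.all _).smul hH
  have := (selfAdjoint.expUnitary ⟨(-r) • H, h⟩).2
  rw [selfAdjoint.expUnitary_coe] at this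
  have e : (-(Complex.I * (r : ℂ))) • H = Complex.I • ((-r) • H) := by
    rw [← Complex.coe_smul, smul_smul]
    push_cast
    ring_nf
  rw [e]
  exact this

lemma norm_le_one_of_mem_unitary {U : 𝔸} (hU : U ∈ unitary 𝔸) : ‖U‖ ≤ 1 := by
  -- In the zero algebra a unitary has norm 0.
  rcases subsingleton_or_nontrivial 𝔸 with h | h
  · rw [Subsingleton.elim U 0]; simp
  · exact (CStarRing.norm_of_mem_unitary hU).le

/-- The evolution up to the `j`-th Uhrig time under `A ± σ C` with alternating signs: the Uhrig
protocol on the eigenspace `Z = σ` of the qubit. -/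
def branchPropagator (A C : 𝔸) (σ : ℂ) (K : ℕ) (T : ℝ) : ℕ → 𝔸
  | 0 => 1
  | j + 1 => NormedSpace.exp ((-(Complex.I * (uhrigInterval K T j : ℂ))) •
      (A + (σ * (-1) ^ j) • C)) * branchPropagator A C σ K T j

variable {A C : 𝔸} (hA : IsSelfAdjoint A) (hC : IsSelfAdjoint C)

include hA hC in
lemma isSelfAdjoint_add_sign_smul {σ : ℂ} (hσ : σ = 1 ∨ σ = -1) (j : ℕ) :
    IsSelfAdjoint (A + (σ * (-1) ^ j) • C) := by
  refine hA.add (IsSelfAdjoint.smul ?_ hC)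
  rcases hσ with rfl | rfl <;> simp [isSelfAdjoint_iff]

include hA hC in
lemma branchPropagator_mem_unitary {σ : ℂ} (hσ : σ = 1 ∨ σ = -1) (K : ℕ) (T : ℝ) (j : ℕ) :
    branchPropagator A C σ K T j ∈ unitary 𝔸 := by
  induction j with
  | zero => exact one_mem _
  | succ j ih =>
    exact mul_mem (exp_neg_I_smul_mem_unitary (isSelfAdjoint_add_sign_smul hA hC hσ j) _) ih

/-- In the angle with `t = T / 2 * (1 - cos θ)` the switching instants are equidistant. -/
lemma uhrigTime_eq (K : ℕ) (T : ℝ) (j : ℕ) :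
    uhrigTime K T j = T / 2 * (1 - Real.cos (j * (Real.pi / (K + 1 : ℕ)))) := by
  have : (j : ℝ) * (Real.pi / (K + 1 : ℕ)) = 2 * (j * Real.pi / (2 * K + 2)) := by
    push_cast
    field_simp
  rw [uhrigTime, Real.sin_sq_eq_half_sub, this]
  ring

lemma uhrigInterval_eq (K : ℕ) (T : ℝ) (j : ℕ) : uhrigInterval K T j =
    T / 2 * (Real.cos (j * (Real.pi / (K + 1 : ℕ))) -
      Real.cos ((j + 1) * (Real.pi / (K + 1 : ℕ)))) := by
  rw [uhrigInterval, uhrigTime_eq, uhrigTime_eq]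
  push_cast
  ring

-- Induction over the intervals: each propagator is a contraction, so the local truncation errors
-- simply add. At `θ = 0` the series is exact.
include hA hC in
lemma exists_norm_branchSum_sub_propagator_le {σ : ℂ} (hσ : σ = 1 ∨ σ = -1) (K : ℕ) (j : ℕ) :
    ∃ R : ℝ, ∀ T : ℝ, 0 ≤ T →
      ‖(∑ n ∈ Finset.range (K + 1), (-(Complex.I * (T / 2 : ℝ))) ^ n •
        branchTerm (K + 1) A C σ n (j * (Real.pi / (K + 1 : ℕ)))) -
        branchPropagator A C σ K T j‖ ≤ R * T ^ (K + 1) := by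
  induction j with
  | zero =>
    refine ⟨0, fun T _ => ?_⟩
    rw [Finset.sum_range_succ', Finset.sum_eq_zero]
    · simp [branchTerm, dysonTerm, branchPropagator]
    · intro n _
      simp [branchTerm, dysonTerm]
  | succ j ih =>
    obtain ⟨R₁, hR₁⟩ := ih
    obtain ⟨R₂, hR₂⟩ := isCompact_Icc.exists_bound_of_continuousOn (s := Set.Icc
      ((j : ℝ) * (Real.pi / (K + 1 : ℕ))) ((j + 1) * (Real.pi / (K + 1 : ℕ))))
      (continuous_branchTerm A C σ (Nat.lt_succ_self K)).continuousOn
    have hσ2 : σ ^ 2 = 1 := by rcases hσ with rfl | rfl <;> norm_num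
    set M := A + (σ * (-1) ^ j) • C with hM
    have hMs : IsSelfAdjoint M := isSelfAdjoint_add_sign_smul hA hC hσ j
    -- The absolute value makes the coefficient nonnegative, as needed to replace `‖l‖ = T / 2` by
    -- `T`.
    refine ⟨‖M‖ * |R₂| * (Real.pi / (K + 1 : ℕ)) + R₁, fun T hT => ?_⟩
    have hrot : ∀ r : ℝ, r • (-(Complex.I * ((T / 2 : ℝ) : ℂ))) • M =
        (-(Complex.I * ((T / 2 * r : ℝ) : ℂ))) • M := by
      intro r
      rw [← Complex.coe_smul, smul_smul]
      push_cast
      ring_nf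
    have step := norm_branchSum_sub_le (Nat.succ_ne_zero K) A C hσ2 j
      (-(Complex.I * ((T / 2 : ℝ) : ℂ))) (fun r => by
        rw [hrot]
        exact norm_le_one_of_mem_unitary (exp_neg_I_smul_mem_unitary hMs _))
      (R := |R₂|) (fun θ hθ => (hR₂ θ hθ).trans (le_abs_self _))
    rw [← hM, hrot] at step
    simp only [Nat.succ_eq_add_one] at step
    rw [← uhrigInterval_eq] at step
    have hl : ‖-(Complex.I * ((T / 2 : ℝ) : ℂ))‖ ≤ T := by
      rw [norm_neg, norm_mul, Complex.norm_I, one_mul, Complex.norm_real, Real.norm_eq_abs,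
        abs_of_nonneg (by positivity)]
      linarith
    set V := NormedSpace.exp ((-(Complex.I * (uhrigInterval K T j : ℂ))) • M) with hV
    have hVn : ‖V‖ ≤ 1 := norm_le_one_of_mem_unitary (exp_neg_I_smul_mem_unitary hMs _)
    have hprop : branchPropagator A C σ K T (j + 1) = V * branchPropagator A C σ K T j := rfl
    rw [hprop]
    push_cast at step ⊢
    refine (norm_sub_le_norm_sub_add_norm_sub _ _ _).trans (add_le_add step ?_) |>.trans
      (?_ : _ + R₁ * T ^ (K + 1) ≤ _)
    · have h := hR₁ T hT
      push_cast at h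
      rw [← mul_sub]
      exact (norm_mul_le _ _).trans ((mul_le_of_le_one_left (norm_nonneg _) hVn).trans h)
    · rw [add_mul]
      push_cast at hl
      gcongr

include hA hC in
/-- The two branches of the Uhrig protocol agree up to order `K` in the total time. -/
lemma exists_norm_branchPropagator_sub_le (K : ℕ) :
    ∃ R : ℝ, ∀ T : ℝ, 0 ≤ T →
      ‖branchPropagator A C 1 K T (K + 1) - branchPropagator A C (-1) K T (K + 1)‖ ≤
        R * T ^ (K + 1) := by
  obtain ⟨R₁, h₁⟩ := exists_norm_branchSum_sub_propagator_le hA hC (Or.inl rfl) K (K + 1)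
  obtain ⟨R₂, h₂⟩ := exists_norm_branchSum_sub_propagator_le hA hC (Or.inr rfl) K (K + 1)
  refine ⟨R₁ + R₂, fun T hT => ?_⟩
  have e1 := h₁ T hT
  have e2 := h₂ T hT
  have hpi : ((K + 1 : ℕ) : ℝ) * (Real.pi / (K + 1 : ℕ)) = Real.pi := by
    field_simp
  have hs : ∀ σ : ℂ, ∑ n ∈ Finset.range (K + 1), (-(Complex.I * (T / 2 : ℝ))) ^ n •
      branchTerm (K + 1) A C σ n Real.pi = ∑ n ∈ Finset.range (K + 1),
      (-(Complex.I * (T / 2 : ℝ))) ^ n • (dysonTerm (K + 1) A C n).1 Real.pi := by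
    intro σ
    refine Finset.sum_congr rfl fun n hn => ?_
    rw [branchTerm, dysonTerm_snd_pi A C (Finset.mem_range.1 hn), smul_zero, add_zero]
  rw [hpi, hs] at e1 e2
  rw [norm_sub_rev] at e1
  rw [add_mul]
  exact (norm_sub_le_norm_sub_add_norm_sub _ _ _).trans (add_le_add e1 e2)

end Branches

/-! ### Bath traces through Hilbert–Schmidt square roots. -/

section Trace

variable {B ι : Type*} [NormedAddCommGroup B] [InnerProductSpace ℂ B] [CompleteSpace B]

open scoped InnerProductSpace ENNReal

open ContinuousLinearMap in
/-- The squared Hilbert–Schmidt norms of an operator and of its adjoint agree. -/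
lemma tsum_enorm_sq_adjoint (b : HilbertBasis ι ℂ B) (A : B →L[ℂ] B) :
    ∑' k, ENNReal.ofReal (‖adjoint A (b k)‖ ^ 2) = ∑' k, ENNReal.ofReal (‖A (b k)‖ ^ 2) := by
  have parseval : ∀ x : B, ENNReal.ofReal (‖x‖ ^ 2) =
      ∑' l, ENNReal.ofReal (‖inner ℂ (b l) x‖ ^ 2) := by
    intro x
    have h := b.hasSum_inner_mul_inner x x
    have h2 : HasSum (fun l => ‖inner ℂ (b l) x‖ ^ 2) (‖x‖ ^ 2) := by
      have h3 := Complex.hasSum_re h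
      convert h3 using 1
      · ext l
        rw [← inner_conj_symm x (b l), ← Complex.normSq_eq_conj_mul_self, Complex.ofReal_re,
          Complex.normSq_eq_norm_sq]
      · rw [inner_self_eq_norm_sq_to_K]
        norm_cast
    rw [← h2.tsum_eq, ENNReal.ofReal_tsum_of_nonneg (fun _ => by positivity) h2.summable]
  -- In `ℝ≥0∞` the double sum of squared matrix entries may be exchanged without summability.
  simp_rw [parseval]
  rw [ENNReal.tsum_comm]
  refine tsum_congr fun l => tsum_congr fun k => ?_
  rw [adjoint_inner_right, ← inner_conj_symm, RCLike.norm_conj]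

-- For a square root `S` of a state, `S V†` is the adjoint of `V S`, so both have the same
-- Hilbert–Schmidt norm. This replaces cyclicity of the trace.
open ContinuousLinearMap in
lemma summable_norm_sq_adjoint_mul {b : HilbertBasis ι ℂ B} {S : B →L[ℂ] B}
    (hS : HasSum (fun k => ‖S (b k)‖ ^ 2) 1) (hSa : adjoint S = S) (V : B →L[ℂ] B) :
    Summable (fun k => ‖S (adjoint V (b k))‖ ^ 2) ∧
    ∑' k, ‖S (adjoint V (b k))‖ ^ 2 ≤ ‖V‖ ^ 2 ∧
    ((∀ x, ‖V x‖ = ‖x‖) → ∑' k, ‖S (adjoint V (b k))‖ ^ 2 = 1) := by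
  have h := tsum_enorm_sq_adjoint b (V * S)
  have e : adjoint (V * S) = S * adjoint V := by
    rw [← star_eq_adjoint, star_mul, star_eq_adjoint, star_eq_adjoint, hSa]
  rw [e] at h
  simp only [mul_apply_eq_comp] at h
  have hle : ∀ k, ‖V (S (b k))‖ ^ 2 ≤ ‖V‖ ^ 2 * ‖S (b k)‖ ^ 2 := fun k => by
    rw [← mul_pow]
    gcongr
    exact V.le_opNorm _
  have hsum : Summable fun k => ‖V (S (b k))‖ ^ 2 :=
    Summable.of_nonneg_of_le (fun _ => by positivity) hle (hS.summable.mul_left _)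
  have hsum' : Summable fun k => ‖S (adjoint V (b k))‖ ^ 2 := by
    have hne : ∑' k, ENNReal.ofReal (‖S (adjoint V (b k))‖ ^ 2) ≠ ∞ := by
      rw [h, ← ENNReal.ofReal_tsum_of_nonneg (fun _ => by positivity) hsum]
      exact ENNReal.ofReal_ne_top
    have := ENNReal.summable_toReal hne
    simpa only [ENNReal.toReal_ofReal (sq_nonneg _)] using this
  rw [← ENNReal.ofReal_tsum_of_nonneg (fun _ => by positivity) hsum,
    ← ENNReal.ofReal_tsum_of_nonneg (fun _ => by positivity) hsum',
    ENNReal.ofReal_eq_ofReal_iff (tsum_nonneg fun _ => by positivity)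
      (tsum_nonneg fun _ => by positivity)] at h
  rw [h]
  refine ⟨hsum', ?_, fun hV => ?_⟩
  · calc _ ≤ ∑' k, ‖V‖ ^ 2 * ‖S (b k)‖ ^ 2 :=
          hsum.tsum_le_tsum hle (hS.summable.mul_left _)
      _ = ‖V‖ ^ 2 := by rw [tsum_mul_left, hS.tsum_eq, mul_one]
  · simp only [hV, hS.tsum_eq]

open ContinuousLinearMap in
lemma IsBathState.exists_sqrt {b : HilbertBasis ι ℂ B} {ρ : B →L[ℂ] B} (hρ : IsBathState b ρ) :
    ∃ S : B →L[ℂ] B, adjoint S = S ∧ S * S = ρ ∧ HasSum (fun k => ‖S (b k)‖ ^ 2) 1 := by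
  have h0 : 0 ≤ ρ := (nonneg_iff_isPositive ρ).2 hρ.1
  have hSa : adjoint (CFC.sqrt ρ) = CFC.sqrt ρ :=
    (IsSelfAdjoint.of_nonneg (CFC.sqrt_nonneg ρ)).star_eq
  have hSS : CFC.sqrt ρ * CFC.sqrt ρ = ρ := CFC.sqrt_mul_sqrt_self ρ h0
  refine ⟨CFC.sqrt ρ, hSa, hSS, ?_⟩
  have h := Complex.hasSum_re hρ.2
  rw [Complex.one_re] at h
  convert h using 1
  ext k
  conv_rhs => rw [← hSS, mul_apply_eq_comp]
  rw [← adjoint_inner_left, hSa, inner_self_eq_norm_sq_to_K]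
  norm_cast

open ContinuousLinearMap in
lemma inner_mul_mul_star {S : B →L[ℂ] B} (hSa : adjoint S = S) (V W : B →L[ℂ] B) (x : B) :
    inner ℂ x ((V * (S * S) * star W) x) = inner ℂ (S (adjoint V x)) (S (adjoint W x)) := by
  simp only [mul_apply_eq_comp, star_eq_adjoint]
  rw [← adjoint_inner_left V, ← adjoint_inner_left S, hSa]

open ContinuousLinearMap in
/-- `V ρ W†` is trace class for a state `ρ`, with trace at most `‖V‖ ‖W‖`. -/
lemma IsBathState.trace_mul_mul_star {b : HilbertBasis ι ℂ B} {ρ : B →L[ℂ] B}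
    (hρ : IsBathState b ρ) (V W : B →L[ℂ] B) :
    Summable (fun k => inner ℂ (b k) ((V * ρ * star W) (b k))) ∧
    ‖bathTrace b (V * ρ * star W)‖ ≤ ‖V‖ * ‖W‖ := by
  obtain ⟨S, hSa, rfl, hS⟩ := hρ.exists_sqrt
  obtain ⟨s1, l1, -⟩ := summable_norm_sq_adjoint_mul hS hSa V
  obtain ⟨s2, l2, -⟩ := summable_norm_sq_adjoint_mul hS hSa W
  simp only [bathTrace, inner_mul_mul_star hSa]
  simp only [← Real.rpow_two] at s1 s2 l1 l2
  -- Cauchy–Schwarz for the Hilbert–Schmidt pairing of `S V†` and `S W†`.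
  obtain ⟨h1, h2⟩ := Real.summable_and_inner_le_Lp_mul_Lq_tsum_of_nonneg
    Real.HolderConjugate.two_two (fun _ => norm_nonneg _) (fun _ => norm_nonneg _) s1 s2
  have hn : Summable fun k => ‖inner ℂ (S (adjoint V (b k))) (S (adjoint W (b k)))‖ :=
    Summable.of_nonneg_of_le (fun _ => norm_nonneg _) (fun k => norm_inner_le_norm _ _) h1
  refine ⟨hn.of_norm, (norm_tsum_le_tsum_norm hn).trans
    ((hn.tsum_le_tsum (fun k => norm_inner_le_norm _ _) h1).trans (h2.trans ?_))⟩
  rw [← Real.sqrt_eq_rpow, ← Real.sqrt_eq_rpow]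
  simp only [Real.rpow_two] at l1 l2 ⊢
  gcongr
  · exact (Real.sqrt_le_left (norm_nonneg _)).2 l1
  · exact (Real.sqrt_le_left (norm_nonneg _)).2 l2

open ContinuousLinearMap in
lemma IsBathState.trace_unitary_conj {b : HilbertBasis ι ℂ B} {ρ : B →L[ℂ] B}
    (hρ : IsBathState b ρ) {U : B →L[ℂ] B} (hU : U ∈ unitary (B →L[ℂ] B)) :
    bathTrace b (U * ρ * star U) = 1 := by
  obtain ⟨S, hSa, rfl, hS⟩ := hρ.exists_sqrt
  obtain ⟨-, -, h⟩ := summable_norm_sq_adjoint_mul hS hSa U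
  simp only [bathTrace, inner_mul_mul_star hSa, inner_self_eq_norm_sq_to_K]
  have := h fun x => ContinuousLinearMap.norm_map_of_mem_unitary hU x
  have h2 := congrArg (fun r : ℝ => (r : ℂ)) this
  simpa [Complex.ofReal_tsum] using h2

omit [CompleteSpace B] in
lemma bathTrace_add {b : HilbertBasis ι ℂ B} {A C : B →L[ℂ] B}
    (hA : Summable fun k => inner ℂ (b k) (A (b k)))
    (hC : Summable fun k => inner ℂ (b k) (C (b k))) :
    bathTrace b (A + C) = bathTrace b A + bathTrace b C := by
  simp only [bathTrace, add_apply, inner_add_right]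
  exact hA.tsum_add hC

omit [CompleteSpace B] in
lemma bathTrace_sub {b : HilbertBasis ι ℂ B} {A C : B →L[ℂ] B}
    (hA : Summable fun k => inner ℂ (b k) (A (b k)))
    (hC : Summable fun k => inner ℂ (b k) (C (b k))) :
    bathTrace b (A - C) = bathTrace b A - bathTrace b C := by
  simp only [bathTrace, sub_apply, inner_sub_right]
  exact hA.tsum_sub hC

omit [CompleteSpace B] in
lemma bathTrace_smul (b : HilbertBasis ι ℂ B) (c : ℂ) (A : B →L[ℂ] B) :
    bathTrace b (c • A) = c * bathTrace b A := by
  simp only [bathTrace, smul_apply, inner_smul_right]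
  exact tsum_mul_left

variable {b : HilbertBasis ι ℂ B} {ρ U W : B →L[ℂ] B} (hρ : IsBathState b ρ)
  (hU : U ∈ unitary (B →L[ℂ] B)) (hW : W ∈ unitary (B →L[ℂ] B))

-- As `1 = tr (U ρ U†)`, the difference is `tr (U ρ (W - U)†)`.
include hρ hU in
lemma IsBathState.norm_trace_unitary_sub_one_le (W : B →L[ℂ] B) :
    ‖bathTrace b (U * ρ * star W) - 1‖ ≤ ‖U - W‖ := by
  rw [← hρ.trace_unitary_conj hU, ← bathTrace_sub (hρ.trace_mul_mul_star U W).1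
    (hρ.trace_mul_mul_star U U).1, ← mul_sub, ← star_sub]
  refine (hρ.trace_mul_mul_star U (W - U)).2.trans ?_
  rw [norm_sub_rev W U]
  exact mul_le_of_le_one_left (norm_nonneg _) (norm_le_one_of_mem_unitary hU)

-- Up to sign, the left side is `tr ((U - W) ρ (U - W)†)`, which is quadratic in `U - W`; this is
-- the gain from randomization.
include hρ hU hW in
lemma IsBathState.norm_trace_add_trace_sub_two_le :
    ‖bathTrace b (U * ρ * star W) + bathTrace b (W * ρ * star U) - 2‖ ≤ ‖U - W‖ ^ 2 := by
  have s := fun V V' => (hρ.trace_mul_mul_star V V').1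
  have e : (U - W) * ρ * star (U - W) = (U * ρ * star U - U * ρ * star W) -
      (W * ρ * star U - W * ρ * star W) := by
    rw [star_sub]
    noncomm_ring
  have h := (hρ.trace_mul_mul_star (U - W) (U - W)).2
  have l1 := bathTrace_sub (s U U) (s U W)
  have l2 := bathTrace_sub (s W U) (s W W)
  have l3 := bathTrace_sub (b := b) (A := U * ρ * star U - U * ρ * star W)
    (C := W * ρ * star U - W * ρ * star W)
    (by simpa [inner_sub_right] using (s U U).sub (s U W))
    (by simpa [inner_sub_right] using (s W U).sub (s W W))
  rw [e, l3, l1, l2, hρ.trace_unitary_conj hU, hρ.trace_unitary_conj hW, ← sq] at h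
  rw [← norm_neg]
  refine le_of_eq_of_le (congrArg norm ?_) h
  ring

end Trace

/-! ### Trace norm and coherences of a qubit. -/

section TraceNorm

open scoped ComplexOrder

/-- The trace norm is at most `n` times the Frobenius norm. -/
lemma traceNorm_le (M : SysOp) : traceNorm M ≤ 2 * Real.sqrt (∑ i, ∑ j, ‖M i j‖ ^ 2) := by
  have hH := Matrix.isHermitian_conjTranspose_mul_self M
  have hnn : ∀ i, 0 ≤ hH.eigenvalues i :=
    (Matrix.posSemidef_conjTranspose_mul_self M).eigenvalues_nonneg
  have htr : ∑ i, hH.eigenvalues i = ∑ i, ∑ j, ‖M i j‖ ^ 2 := by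
    have h := hH.trace_eq_sum_eigenvalues
    have h2 : (M.conjTranspose * M).trace = ((∑ i, ∑ j, ‖M i j‖ ^ 2 : ℝ) : ℂ) := by
      simp only [Matrix.trace, Matrix.diag, Matrix.mul_apply, Matrix.conjTranspose_apply]
      rw [Finset.sum_comm]
      push_cast
      refine Finset.sum_congr rfl fun i _ => Finset.sum_congr rfl fun j _ => ?_
      rw [← Complex.conj_mul']
      rfl
    rw [h2] at h
    exact (RCLike.ofReal_injective (K := ℂ) (by simpa using h)).symm
  unfold traceNorm
  -- Each squared singular value is at most their sum `tr (M† M)`.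
  rw [Fin.sum_univ_two, two_mul, ← htr]
  gcongr <;> exact Finset.single_le_sum (fun i _ => hnn i) (Finset.mem_univ _)

lemma traceNorm_le_of_offDiag {M : SysOp} {r : ℝ} (hr : 0 ≤ r) (h0 : M 0 0 = 0) (h1 : M 1 1 = 0)
    (h01 : ‖M 0 1‖ ≤ r) (h10 : ‖M 1 0‖ ≤ r) : traceNorm M ≤ 4 * r := by
  refine (traceNorm_le M).trans ?_
  have : Real.sqrt (∑ i, ∑ j, ‖M i j‖ ^ 2) ≤ 2 * r := by
    rw [Real.sqrt_le_left (by positivity)]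
    simp only [Fin.sum_univ_two, h0, h1, norm_zero]
    nlinarith [norm_nonneg (M 0 1), norm_nonneg (M 1 0)]
  linarith

/-- Nonnegativity of the determinant bounds the squared coherence by the product of two populations
that sum to 1. -/
lemma IsSystemState.norm_apply_le_one {ρ : SysOp} (hρ : IsSystemState ρ) :
    ‖ρ 0 1‖ ≤ 1 ∧ ‖ρ 1 0‖ ≤ 1 := by
  obtain ⟨hp, ht⟩ := hρ
  have hdet := hp.det_nonneg
  have hd : ∀ i, 0 ≤ ρ i i := fun i => hp.diag_nonneg
  have hh : ρ 1 0 = star (ρ 0 1) := (hp.1.apply 1 0).symm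
  have hn : ‖ρ 1 0‖ = ‖ρ 0 1‖ := by rw [hh, norm_star]
  rw [hn, and_self]
  have h0 := Complex.le_def.1 (hd 0)
  have h1 := Complex.le_def.1 (hd 1)
  have ht' := congrArg Complex.re ht
  rw [Matrix.trace_fin_two, Complex.add_re, Complex.one_re] at ht'
  rw [Matrix.det_fin_two, hh] at hdet
  have hdet' := (Complex.le_def.1 hdet).1
  have hm : (ρ 0 1 * star (ρ 0 1)).re = ‖ρ 0 1‖ ^ 2 := by
    rw [Complex.star_def, Complex.mul_conj, Complex.normSq_eq_norm_sq, Complex.ofReal_re]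
  rw [Complex.sub_re, hm, Complex.mul_re, ← h0.2, ← h1.2] at hdet'
  simp only [Complex.zero_re, Complex.zero_im] at hdet' h0 h1
  nlinarith [norm_nonneg (ρ 0 1)]

end TraceNorm

/-! ### Realization by pulses: evolution, duration, pulse count. -/

section Pulses

variable {B : Type*} [NormedAddCommGroup B] [InnerProductSpace ℂ B]

lemma tensor_mul_tensor_one (P Q : SysOp) :
    (tensor P 1 : JointOp B) * tensor Q 1 = tensor (P * Q) 1 := by
  ext1 i j
  simp only [tensor, Matrix.mul_apply, Matrix.of_apply, smul_mul_smul_comm, one_mul,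
    Finset.sum_smul]

lemma tensor_one_one : (tensor 1 1 : JointOp B) = 1 := by
  ext1 i j
  by_cases h : i = j <;> simp [tensor, Matrix.one_apply, h]

lemma pauliX_mul_self : pauliX * pauliX = 1 := by
  simp [pauliX, Matrix.one_fin_two]

lemma conjTranspose_pauliX : pauliX.conjTranspose = pauliX := by
  ext i j
  fin_cases i <;> fin_cases j <;> simp [pauliX]

lemma pauliX_ne_one : pauliX ≠ 1 := by
  intro h
  simpa [pauliX] using congrFun (congrFun h 0) 0

lemma evolution_append (H : JointOp B) (s t : List Step) :
    evolution H (s ++ t) = evolution H t * evolution H s := by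
  have key : ∀ (t : List Step) (U : JointOp B),
      t.foldl (fun U a => a.toOp H * U) U = evolution H t * U := by
    intro t
    induction t with
    | nil => intro U; simp [evolution]
    | cons a t ih =>
      intro U
      rw [List.foldl_cons, ih,
        show evolution H (a :: t) = evolution H t * (a.toOp H * 1) from ih _]
      simp [mul_assoc]
  rw [evolution, List.foldl_append, key]
  rfl

lemma evolution_pair (H : JointOp B) (P : SysOp) (τ : ℝ) :
    evolution H [.pulse P, .free τ] = freeEvolution H τ * tensor P 1 := by
  simp [evolution, Step.toOp]

lemma totalTime_append (s t : List Step) : totalTime (s ++ t) = totalTime s + totalTime t := by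
  simp [totalTime]

lemma pulseCount_append (s t : List Step) :
    pulseCount (s ++ t) = pulseCount s + pulseCount t := by
  simp [pulseCount, List.countP_append]

lemma pulseCount_pair_le (P : SysOp) (τ : ℝ) : pulseCount [.pulse P, .free τ] ≤ 1 := by
  rw [pulseCount, List.countP_cons, List.countP_cons]
  split_ifs <;> simp_all

lemma totalTime_uhrigSequence (K : ℕ) (T : ℝ) (g : SysOp) :
    totalTime (uhrigSequence K T g) = T := by
  have key : ∀ n, totalTime ((List.range n).flatMap (fun j =>
      [Step.pulse ((toggle (j + 1)).conjTranspose * toggle j),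
        .free (uhrigInterval K T (j + 1))])) = uhrigTime K T (n + 1) - uhrigTime K T 1 := by
    intro n
    induction n with
    | zero => simp [totalTime]
    | succ n ih =>
      rw [List.range_succ, List.flatMap_append, totalTime_append, ih]
      simp [totalTime, Step.duration, uhrigInterval]
  have h0 : uhrigTime K T 0 = 0 := by simp [uhrigTime]
  have h1 : uhrigTime K T (K + 1) = T := by
    rw [uhrigTime, show ((K + 1 : ℕ) : ℝ) * Real.pi / (2 * K + 2) = Real.pi / 2 by
      push_cast; field_simp]
    simp
  rw [uhrigSequence, totalTime_append, totalTime_append, key, h1]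
  simp [totalTime, Step.duration, uhrigInterval, h0]

lemma pulseCount_uhrigSequence_le (K : ℕ) (T : ℝ) (g : SysOp) :
    pulseCount (uhrigSequence K T g) ≤ K + 2 := by
  have key : ∀ n, pulseCount ((List.range n).flatMap (fun j =>
      [Step.pulse ((toggle (j + 1)).conjTranspose * toggle j),
        .free (uhrigInterval K T (j + 1))])) ≤ n := by
    intro n
    induction n with
    | zero => simp [pulseCount]
    | succ n ih =>
      rw [List.range_succ, List.flatMap_append, pulseCount_append]
      exact add_le_add ih (by simpa using pulseCount_pair_le _ _)
  have hlast : pulseCount [Step.pulse (g * toggle K)] ≤ 1 :=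
    List.countP_le_length
  rw [uhrigSequence, pulseCount_append, pulseCount_append]
  have := key K
  have := pulseCount_pair_le ((toggle 0).conjTranspose * g.conjTranspose) (uhrigInterval K T 0)
  omega

variable [CompleteSpace B]

lemma conjTranspose_tensor_one (P : SysOp) :
    (tensor P 1 : JointOp B).conjTranspose = tensor P.conjTranspose 1 := by
  ext1 i j
  simp [tensor, Matrix.conjTranspose_apply]

lemma uhrigDD_prefix_succ (H : JointOp B) (K : ℕ) (T : ℝ) (n : ℕ) :
    (((List.range (n + 1)).reverse).map fun j =>
      tensor (toggle j) 1 * freeEvolution H (uhrigInterval K T j) *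
        (tensor (toggle j) 1).conjTranspose).prod =
    (tensor (toggle n) 1 * freeEvolution H (uhrigInterval K T n) *
        (tensor (toggle n) 1).conjTranspose) *
      (((List.range n).reverse).map fun j =>
      tensor (toggle j) 1 * freeEvolution H (uhrigInterval K T j) *
        (tensor (toggle j) 1).conjTranspose).prod := by
  simp [List.range_succ]

lemma evolution_uhrigSequence (H : JointOp B) (K : ℕ) (T : ℝ) (g : SysOp) :
    evolution H (uhrigSequence K T g) =
      tensor g 1 * uhrigDD H K T * (tensor g 1).conjTranspose := by
  -- The pending factor `toggle n` is what the next pulse splits off, or the final pulse `g * toggle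
  -- K` supplies; with it, the prefix is exactly a partial product of `D`, times `g†`.
  have key : ∀ n, tensor (toggle n) 1 * (evolution H ([Step.pulse ((toggle 0).conjTranspose *
      g.conjTranspose), .free (uhrigInterval K T 0)] ++ (List.range n).flatMap (fun j =>
      [Step.pulse ((toggle (j + 1)).conjTranspose * toggle j),
        .free (uhrigInterval K T (j + 1))]))) =
      (((List.range (n + 1)).reverse).map fun j =>
        tensor (toggle j) 1 * freeEvolution H (uhrigInterval K T j) *
          (tensor (toggle j) 1).conjTranspose).prod * tensor g.conjTranspose 1 := by
    intro n
    induction n with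
    | zero =>
      simp [evolution_pair, conjTranspose_tensor_one, ← tensor_mul_tensor_one, mul_assoc]
    | succ n ih =>
      rw [List.range_succ, List.flatMap_append, ← List.append_assoc, evolution_append,
        uhrigDD_prefix_succ, mul_assoc _ _ (tensor g.conjTranspose 1), ← ih]
      simp only [List.flatMap_cons, List.flatMap_nil, List.append_nil, evolution_pair,
        conjTranspose_tensor_one, ← tensor_mul_tensor_one, mul_assoc]
  rw [uhrigSequence, evolution_append, uhrigDD, conjTranspose_tensor_one, mul_assoc, ← key]
  simp [evolution, Step.toOp, ← tensor_mul_tensor_one, mul_assoc]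

end Pulses

/-! ### Block form of the protocols in the eigenbasis of `Z`. -/

section Blocks

variable {B : Type*} [NormedAddCommGroup B] [InnerProductSpace ℂ B] [CompleteSpace B]

omit [CompleteSpace B] in
lemma dephasingHamiltonian_eq_diagonal (BI BZ : B →L[ℂ] B) :
    dephasingHamiltonian BI BZ = Matrix.diagonal ![BI + BZ, BI - BZ] := by
  ext1 i j
  fin_cases i <;> fin_cases j <;>
    simp [dephasingHamiltonian, tensor, pauliZ, sub_eq_add_neg]

lemma freeEvolution_diagonal (v : Fin 2 → (B →L[ℂ] B)) (τ : ℝ) :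
    freeEvolution (Matrix.diagonal v) τ =
      Matrix.diagonal fun i => NormedSpace.exp ((-(Complex.I * (τ : ℂ))) • v i) := by
  let _ : NormedAlgebra ℚ (B →L[ℂ] B) := NormedAlgebra.restrictScalars ℚ ℂ _
  rw [freeEvolution, ← Matrix.diagonal_smul, Matrix.exp_diagonal]
  congr 1
  ext1 i
  rw [Pi.coe_exp]
  rfl

/-- Conjugation by the pulse `X` exchanges the two diagonal blocks. -/
lemma pauliX_conj_diagonal (U W : B →L[ℂ] B) :
    tensor pauliX 1 * Matrix.diagonal ![U, W] * (tensor pauliX 1).conjTranspose =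
      Matrix.diagonal ![W, U] := by
  rw [conjTranspose_tensor_one, conjTranspose_pauliX]
  ext1 i j
  fin_cases i <;> fin_cases j <;>
    simp [tensor, pauliX, Matrix.mul_apply, Fin.sum_univ_two]

/-- Indexing the blocks by the sign `σ` turns the swap by `X` into `σ ↦ -σ`, matching the recursion
of `branchPropagator`. -/
lemma toggle_conj_diagonal (U : ℂ → (B →L[ℂ] B)) (j : ℕ) :
    tensor (toggle j) 1 * Matrix.diagonal ![U 1, U (-1)] * (tensor (toggle j) 1).conjTranspose =
      Matrix.diagonal ![U (1 * (-1) ^ j), U (-1 * (-1) ^ j)] := by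
  rcases Nat.even_or_odd j with h | h
  · have : toggle j = 1 := by
      obtain ⟨k, rfl⟩ := h
      rw [toggle, ← two_mul, pow_mul, pow_two, pauliX_mul_self, one_pow]
    rw [this, tensor_one_one, h.neg_one_pow]
    simp
  · have : toggle j = pauliX := by
      obtain ⟨k, rfl⟩ := h
      rw [toggle, pow_succ, pow_mul, pow_two, pauliX_mul_self, one_pow, one_mul]
    rw [this, h.neg_one_pow, pauliX_conj_diagonal]
    simp

/-- The Uhrig protocol is block diagonal in the eigenbasis of `Z`. -/
lemma uhrigDD_eq_diagonal (BI BZ : B →L[ℂ] B) (K : ℕ) (T : ℝ) :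
    uhrigDD (dephasingHamiltonian BI BZ) K T =
      Matrix.diagonal ![branchPropagator BI BZ 1 K T (K + 1),
        branchPropagator BI BZ (-1) K T (K + 1)] := by
  have key : ∀ n, (((List.range n).reverse).map fun j => tensor (toggle j) 1 *
      freeEvolution (dephasingHamiltonian BI BZ) (uhrigInterval K T j) *
        (tensor (toggle j) 1).conjTranspose).prod =
      Matrix.diagonal ![branchPropagator BI BZ 1 K T n, branchPropagator BI BZ (-1) K T n] := by
    intro n
    induction n with
    | zero =>
      simp only [List.range_zero, List.reverse_nil, List.map_nil, List.prod_nil, branchPropagator]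
      ext1 i j
      fin_cases i <;> fin_cases j <;> simp
    | succ n ih =>
      rw [uhrigDD_prefix_succ, ih, dephasingHamiltonian_eq_diagonal, freeEvolution_diagonal]
      have h := toggle_conj_diagonal (B := B) (fun σ => NormedSpace.exp
        ((-(Complex.I * (uhrigInterval K T n : ℂ))) • (BI + σ • BZ))) n
      have e : (fun i => NormedSpace.exp ((-(Complex.I * (uhrigInterval K T n : ℂ))) •
          (![BI + BZ, BI - BZ] : Fin 2 → (B →L[ℂ] B)) i)) =
          ![NormedSpace.exp ((-(Complex.I * (uhrigInterval K T n : ℂ))) • (BI + (1 : ℂ) • BZ)),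
          NormedSpace.exp ((-(Complex.I * (uhrigInterval K T n : ℂ))) •
            (BI + (-1 : ℂ) • BZ))] := by
        ext1 i
        fin_cases i <;> simp [sub_eq_add_neg]
      rw [e, h, Matrix.diagonal_mul_diagonal]
      congr 1
      ext1 i
      fin_cases i <;> rfl
  exact key (K + 1)

lemma conjTranspose_diagonal_pair (U W : B →L[ℂ] B) :
    (Matrix.diagonal ![U, W]).conjTranspose = Matrix.diagonal ![star U, star W] := by
  ext1 i j
  fin_cases i <;> fin_cases j <;> simp [Matrix.conjTranspose_apply]

lemma deterministic_diagonal (U W : B →L[ℂ] B) (P : SysOp) (ρ : B →L[ℂ] B) :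
    deterministic (Matrix.diagonal ![U, W]) (tensor P ρ) =
      !![P 0 0 • (U * ρ * star U), P 0 1 • (U * ρ * star W);
        P 1 0 • (W * ρ * star U), P 1 1 • (W * ρ * star W)] := by
  rw [deterministic, conjTranspose_diagonal_pair]
  ext1 i j
  fin_cases i <;> fin_cases j <;> simp [tensor, Matrix.mul_apply, Fin.sum_univ_two]

lemma randomized_diagonal (U W : B →L[ℂ] B) (ρ : JointOp B) :
    randomized decouplingGroup (Matrix.diagonal ![U, W]) ρ =
      (2 : ℂ)⁻¹ • (deterministic (Matrix.diagonal ![U, W]) ρ +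
        deterministic (Matrix.diagonal ![W, U]) ρ) := by
  classical
  have hcard : decouplingGroup.card = 2 := by
    rw [decouplingGroup]
    convert Finset.card_pair pauliX_ne_one.symm
  have hsum : ∀ f : SysOp → JointOp B, ∑ g ∈ decouplingGroup, f g = f 1 + f pauliX := by
    intro f
    rw [decouplingGroup]
    convert Finset.sum_pair (f := f) pauliX_ne_one.symm
  rw [randomized, hcard, hsum, conjTranspose_diagonal_pair, pauliX_conj_diagonal,
    pauliX_conj_diagonal, tensor_one_one, deterministic, deterministic,
    conjTranspose_diagonal_pair, conjTranspose_diagonal_pair]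
  simp

end Blocks

/-! ### Error bounds in terms of `‖U - W‖`. -/

section Fidelity

variable {B ι : Type*} [NormedAddCommGroup B] [InnerProductSpace ℂ B] [CompleteSpace B]
  {b : HilbertBasis ι ℂ B} {ρS : SysOp} {ρB U W : B →L[ℂ] B}
  (hS : IsSystemState ρS) (hB : IsBathState b ρB)
  (hU : U ∈ unitary (B →L[ℂ] B)) (hW : W ∈ unitary (B →L[ℂ] B))

include hS hB hU hW

lemma traceNorm_deterministic_sub_le :
    traceNorm (partialTrace b (deterministic (Matrix.diagonal ![U, W]) (tensor ρS ρB)) - ρS) ≤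
      4 * ‖U - W‖ := by
  rw [deterministic_diagonal]
  have h1 := hB.norm_trace_unitary_sub_one_le hU W
  have h2 := hB.norm_trace_unitary_sub_one_le hW U
  rw [norm_sub_rev W U] at h2
  obtain ⟨n1, n2⟩ := hS.norm_apply_le_one
  refine traceNorm_le_of_offDiag (norm_nonneg _) ?_ ?_ ?_ ?_
  · simp [partialTrace, bathTrace_smul, hB.trace_unitary_conj hU]
  · simp [partialTrace, bathTrace_smul, hB.trace_unitary_conj hW]
  · have e : (partialTrace b !![ρS 0 0 • (U * ρB * star U), ρS 0 1 • (U * ρB * star W);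
        ρS 1 0 • (W * ρB * star U), ρS 1 1 • (W * ρB * star W)] - ρS) 0 1 =
        ρS 0 1 * (bathTrace b (U * ρB * star W) - 1) := by
      simp [partialTrace, bathTrace_smul, mul_sub]
    rw [e, norm_mul]
    exact (mul_le_of_le_one_left (norm_nonneg _) n1).trans h1
  · have e : (partialTrace b !![ρS 0 0 • (U * ρB * star U), ρS 0 1 • (U * ρB * star W);
        ρS 1 0 • (W * ρB * star U), ρS 1 1 • (W * ρB * star W)] - ρS) 1 0 =
        ρS 1 0 * (bathTrace b (W * ρB * star U) - 1) := by
      simp [partialTrace, bathTrace_smul, mul_sub]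
    rw [e, norm_mul]
    exact (mul_le_of_le_one_left (norm_nonneg _) n2).trans h2

lemma traceNorm_randomized_sub_le :
    traceNorm (partialTrace b (randomized decouplingGroup (Matrix.diagonal ![U, W])
      (tensor ρS ρB)) - ρS) ≤ 4 * ‖U - W‖ ^ 2 := by
  rw [randomized_diagonal, deterministic_diagonal, deterministic_diagonal]
  have s := fun V V' => (hB.trace_mul_mul_star V V').1
  have hadd : ∀ V V' Y Y' : B →L[ℂ] B, bathTrace b (V * ρB * star V' + Y * ρB * star Y') =
      bathTrace b (V * ρB * star V') + bathTrace b (Y * ρB * star Y') :=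
    fun V V' Y Y' => bathTrace_add (s V V') (s Y Y')
  have h := hB.norm_trace_add_trace_sub_two_le hU hW
  have h' := hB.norm_trace_add_trace_sub_two_le hW hU
  rw [norm_sub_rev W U] at h'
  obtain ⟨n1, n2⟩ := hS.norm_apply_le_one
  have bound : ∀ c x : ℂ, ‖c‖ ≤ 1 → ‖x‖ ≤ ‖U - W‖ ^ 2 →
      ‖(2 : ℂ)⁻¹ * (c * x)‖ ≤ ‖U - W‖ ^ 2 := by
    intro c x hc hx
    rw [norm_mul, norm_mul]
    have h2 : ‖(2 : ℂ)⁻¹‖ ≤ 1 := by norm_num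
    exact (mul_le_of_le_one_left (by positivity) h2).trans
      ((mul_le_of_le_one_left (norm_nonneg _) hc).trans hx)
  -- One formula serves all four entries: on the diagonal the traces give `1 + 1 - 2 = 0`.
  have entry : ∀ (i j : Fin 2) (M M' : JointOp B) (c : ℂ) (V V' Y Y' : B →L[ℂ] B),
      M i j = c • (V * ρB * star V') → M' i j = c • (Y * ρB * star Y') → ρS i j = c →
      (partialTrace b ((2 : ℂ)⁻¹ • (M + M')) - ρS) i j = (2 : ℂ)⁻¹ *
        (c * (bathTrace b (V * ρB * star V') + bathTrace b (Y * ρB * star Y') - 2)) := by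
    intro i j M M' c V V' Y Y' hM hM' hc
    rw [Matrix.sub_apply, partialTrace, Matrix.of_apply, Matrix.smul_apply, Matrix.add_apply,
      hM, hM', ← smul_add, bathTrace_smul, bathTrace_smul, hadd, hc]
    ring
  refine traceNorm_le_of_offDiag (by positivity) ?_ ?_ ?_ ?_
  · rw [entry 0 0 _ _ _ _ _ _ _ rfl rfl rfl, hB.trace_unitary_conj hU, hB.trace_unitary_conj hW]
    ring
  · rw [entry 1 1 _ _ _ _ _ _ _ rfl rfl rfl, hB.trace_unitary_conj hU, hB.trace_unitary_conj hW]
    ring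
  · rw [entry 0 1 _ _ _ _ _ _ _ rfl rfl rfl]
    exact bound _ _ n1 h
  · rw [entry 1 0 _ _ _ _ _ _ _ rfl rfl rfl]
    exact bound _ _ n2 h'

end Fidelity

end UDD

end

theorem corollary2 {B ι : Type*} [NormedAddCommGroup B] [InnerProductSpace ℂ B] [CompleteSpace B]
    (BI BZ : B →L[ℂ] B) (hBI : IsSelfAdjoint BI) (hBZ : IsSelfAdjoint BZ)
    (K : ℕ) :
    -- the randomized protocol
    (∃ C : ℝ, ∀ᶠ T : ℝ in 𝓝[>] 0, ∀ (b : HilbertBasis ι ℂ B) (ρS : UDD.SysOp)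
        (ρB : B →L[ℂ] B),
      UDD.IsSystemState ρS → UDD.IsBathState b ρB →
      1 / 2 * UDD.traceNorm
        (UDD.partialTrace b (UDD.randomized UDD.decouplingGroup
          (UDD.uhrigDD (UDD.dephasingHamiltonian BI BZ) K T) (UDD.tensor ρS ρB)) - ρS)
        ≤ C * T ^ (2 * K + 2)) ∧
    -- its pulses
    (∀ T : ℝ, 0 < T → ∀ g ∈ UDD.decouplingGroup,
      UDD.evolution (UDD.dephasingHamiltonian BI BZ) (UDD.uhrigSequence K T g) =
        UDD.tensor g 1 * UDD.uhrigDD (UDD.dephasingHamiltonian BI BZ) K T *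
          (UDD.tensor g 1).conjTranspose ∧
      UDD.totalTime (UDD.uhrigSequence K T g) = T ∧
      UDD.pulseCount (UDD.uhrigSequence K T g) ≤ K + 2) ∧
    -- the deterministic protocol
    (∃ C : ℝ, ∀ᶠ T : ℝ in 𝓝[>] 0, ∀ (b : HilbertBasis ι ℂ B) (ρS : UDD.SysOp)
        (ρB : B →L[ℂ] B),
      UDD.IsSystemState ρS → UDD.IsBathState b ρB →
      1 / 2 * UDD.traceNorm
        (UDD.partialTrace b (UDD.deterministic
          (UDD.uhrigDD (UDD.dephasingHamiltonian BI BZ) K T) (UDD.tensor ρS ρB)) - ρS)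
        ≤ C * T ^ (K + 1)) := by
  obtain ⟨R, hR⟩ := UDD.exists_norm_branchPropagator_sub_le hBI hBZ K
  have hU := fun T => UDD.branchPropagator_mem_unitary hBI hBZ (Or.inl rfl) K T (K + 1)
  have hW := fun T => UDD.branchPropagator_mem_unitary hBI hBZ (Or.inr rfl) K T (K + 1)
  -- Each factor 2 is `1 / 2` times the 4 of the trace norm bounds. `R` is fixed before the basis
  -- and the states, which gives uniformity.
  refine ⟨⟨2 * R ^ 2, ?_⟩, fun T _ g _ => ⟨UDD.evolution_uhrigSequence _ K T g,
    UDD.totalTime_uhrigSequence K T g, UDD.pulseCount_uhrigSequence_le K T g⟩, ⟨2 * R, ?_⟩⟩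
  · filter_upwards [self_mem_nhdsWithin] with T hT b ρS ρB hS hB
    have hT' : 0 ≤ T := le_of_lt hT
    rw [UDD.uhrigDD_eq_diagonal]
    have h := UDD.traceNorm_randomized_sub_le hS hB (hU T) (hW T)
    have h2 := pow_le_pow_left₀ (norm_nonneg _) (hR T hT') 2
    rw [mul_pow, ← pow_mul, show (K + 1) * 2 = 2 * K + 2 by ring] at h2
    linarith
  · filter_upwards [self_mem_nhdsWithin] with T hT b ρS ρB hS hB
    have hT' : 0 ≤ T := le_of_lt hT
    rw [UDD.uhrigDD_eq_diagonal]
    have h := UDD.traceNorm_deterministic_sub_le hS hB (hU T) (hW T)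
    linarith [hR T hT']
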